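/- Let $\mathbb K=\mathbb R$ or $\mathbb C$, let $n\in\mathbb N$, let $\widetilde{\mathcal O}=\mathbb K[[x_1,\dots,x_n]]$ with $\mathfrak m=(x_1,\dots,x_n)$, and let $\widetilde{\mathcal D}$ be the free module, with basis $x_i\frac{\partial}{\partial x_i}$, of formal logarithmic derivations, i.e. the $\mathbb K$-derivations of $\widetilde{\mathcal O}$ that preserve the ideal $(x_1\cdots x_n)$. Definitions. For $\lambda\in\mathbb K^n$ put $L(\lambda)=\sum_i\lambda_i x_i\frac{\partial}{\partial x_i}$. A derivation $\partial$ with $\partial(\mathfrak m)\subset\mathfrak m$ is semi-simple (nilpotent) if it induces a semi-simple (nilpotent) endomorphism of $\widetilde{\mathcal O}/\mathfrak m^{k+1}$ for every $k\in\mathbb N$. The Jordan decomposition of $\partial\in\widetilde{\mathcal D}$ is $\partial=\partial_{\rm ss}+\partial_{\rm nilp}$ with $\partial_{\rm ss},\partial_{\rm nilp}\in\widetilde{\mathcal D}$ semi-simple and nilpotent respectively and $[\partial_{\rm ss},\partial_{\rm nilp}]=0$. The Bruno ideal $B(\partial)$ is the ideal of collinearity $\Gamma(\partial_{\rm ss}\wedge\partial_{\rm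 nilp})$: if $\partial_{\rm ss}=\sum_i a_i x_i\frac{\partial}{\partial x_i}$ and $\partial_{\rm nilp}=\sum_i b_i x_i\frac{\partial}{\partial x_i}$, it is the ideal of $\widetilde{\mathcal O}$ generated by all $a_ib_j-a_jb_i$. For $S=L(\lambda)$, an $S$-perturbation is a derivation $\sum_i c_i x_i\frac{\partial}{\partial x_i}\in\widetilde{\mathcal D}$ with $c_i(0)=\lambda_i$ for all $i$. An $S$-perturbation $\delta$ is in normal form modulo a $\delta$-invariant ideal $I$ if $I$ is $S$-invariant and $\delta_{\rm ss}$ and $S$ induce the same derivation of $\widetilde{\mathcal O}/I$ (in particular $I$ is $\delta_{\rm ss}$-invariant). Theorem. Let $\partial\in\widetilde{\mathcal D}$ be any formal logarithmic derivation. Then there are $\lambda\in\mathbb K^n$ and a formal automorphism $\Phi$ (a $\mathbb K$-algebra automorphism of $\widetilde{\mathcal O}$) such that, with $S=L(\lambda)$, the derivation $\partial$ is an $S$-perturbation, $S\neq0$ if $\partial_{\rm ss}\ne0$, the conjugate $\delta=\Phi\,\partial\,\Phi^{-1}$ is an $S$-perturbation which has a Jordan decomposition, its Bruno ideal $B(\delta)$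 is $\delta$-invariant, and $\delta$ is in normal form modulo $B(\delta)$. No arithmetic condition on $\lambda$ is required. -/

import Mathlib

namespace LogDer

variable {𝕜 : Type*} [RCLike 𝕜] {n : ℕ}

/-- The ring of formal power series in `n` variables `x_1, …, x_n`. -/
abbrev Ser (𝕜 : Type*) [RCLike 𝕜] (n : ℕ) : Type _ := MvPowerSeries (Fin n) 𝕜

/-- The derivations of the ring of formal power series. -/
abbrev Der (𝕜 : Type*) [RCLike 𝕜] (n : ℕ) : Type _ := Derivation 𝕜 (Ser 𝕜 n) (Ser 𝕜 n)

/-- The maximal ideal `(x_1, …, x_n)`. -/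
noncomputable def maxIdeal (𝕜 : Type*) [RCLike 𝕜] (n : ℕ) : Ideal (Ser 𝕜 n) :=
  Ideal.span (Set.range fun i : Fin n => (MvPowerSeries.X i : Ser 𝕜 n))

/-- The ideal `(x_1 ⋯ x_n)` of the union of the coordinate hyperplanes. -/
noncomputable def logIdeal (𝕜 : Type*) [RCLike 𝕜] (n : ℕ) : Ideal (Ser 𝕜 n) :=
  Ideal.span {∏ i : Fin n, (MvPowerSeries.X i : Ser 𝕜 n)}

/-- `∂(I) ⊆ I`. -/
def IsInvariant (D : Der 𝕜 n) (I : Ideal (Ser 𝕜 n)) : Prop :=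
  ∀ f ∈ I, D f ∈ I

/-- Logarithmic derivations: those that preserve the ideal `(x_1 ⋯ x_n)`. -/
def IsLogarithmic (D : Der 𝕜 n) : Prop :=
  IsInvariant D (logIdeal 𝕜 n)

/-- The derivation induced on the quotient ring by an invariant ideal. -/
noncomputable def quotientDer (D : Der 𝕜 n) (I : Ideal (Ser 𝕜 n)) (h : IsInvariant D I) :
    Derivation 𝕜 (Ser 𝕜 n ⧸ I) (Ser 𝕜 n ⧸ I) :=
  Derivation.mk'
    { toFun := Quotient.lift (fun f => Ideal.Quotient.mk I (D f)) (by
        intro a b hab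
        have h1 : a - b ∈ I := (Submodule.quotientRel_def I).mp hab
        have h2 := h _ h1
        rw [map_sub] at h2
        exact Ideal.Quotient.eq.mpr h2)
      map_add' := by
        intro a b
        obtain ⟨a, rfl⟩ := Ideal.Quotient.mk_surjective a
        obtain ⟨b, rfl⟩ := Ideal.Quotient.mk_surjective b
        change Ideal.Quotient.mk I (D (a + b)) = _
        rw [map_add, map_add]
        rfl
      map_smul' := by
        intro c a
        obtain ⟨a, rfl⟩ := Ideal.Quotient.mk_surjective a
        change Ideal.Quotient.mk I (D (c • a)) = _
        rw [D.map_smul]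
        rfl }
    (by
      intro a b
      obtain ⟨a, rfl⟩ := Ideal.Quotient.mk_surjective a
      obtain ⟨b, rfl⟩ := Ideal.Quotient.mk_surjective b
      change Ideal.Quotient.mk I (D (a * b)) =
        Ideal.Quotient.mk I a • Ideal.Quotient.mk I (D b)
          + Ideal.Quotient.mk I b • Ideal.Quotient.mk I (D a)
      rw [D.leibniz]
      simp only [smul_eq_mul, map_add, map_mul])

theorem quotientDer_mk (D : Der 𝕜 n) (I : Ideal (Ser 𝕜 n)) (h : IsInvariant D I) (f : Ser 𝕜 n) :
    quotientDer D I h (Ideal.Quotient.mk I f) = Ideal.Quotient.mk I (D f) := rfl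

/-- Local derivations: those with `∂(𝔪) ⊆ 𝔪`. -/
def IsLocalDer (D : Der 𝕜 n) : Prop :=
  IsInvariant D (maxIdeal 𝕜 n)

theorem IsLocalDer.pow {D : Der 𝕜 n} (h : IsLocalDer D) (k : ℕ) :
    IsInvariant D (maxIdeal 𝕜 n ^ k) := by
  induction k with
  | zero => intro f _; simp
  | succ k ih =>
    intro f hf
    rw [pow_succ] at hf ⊢
    refine Submodule.mul_induction_on hf (fun a ha b hb => ?_) (fun a b ha hb => ?_)
    · rw [D.leibniz, smul_eq_mul, smul_eq_mul]
      refine Ideal.add_mem _ (Ideal.mul_mem_mul ha (h b hb)) ?_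
      rw [mul_comm b]
      exact Ideal.mul_mem_mul (ih a ha) hb
    · rw [map_add]
      exact Ideal.add_mem _ ha hb

/-- The endomorphism of the jet space `𝕜[[x]] / 𝔪^{k+1}` induced by a local derivation. -/
noncomputable def jetEnd (D : Der 𝕜 n) (h : IsLocalDer D) (k : ℕ) :
    Module.End 𝕜 (Ser 𝕜 n ⧸ maxIdeal 𝕜 n ^ (k + 1)) :=
  (quotientDer D (maxIdeal 𝕜 n ^ (k + 1)) (h.pow (k + 1))).toLinearMap

/-- A local derivation is semi-simple if it acts semi-simply on every jet space. -/
def IsSemisimpleDer (D : Der 𝕜 n) : Prop :=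
  ∃ h : IsLocalDer D, ∀ k : ℕ, (jetEnd D h k).IsSemisimple

/-- A local derivation is nilpotent if it acts nilpotently on every jet space. -/
def IsNilpotentDer (D : Der 𝕜 n) : Prop :=
  ∃ h : IsLocalDer D, ∀ k : ℕ, IsNilpotent (jetEnd D h k)

/-- `D = S + N` is the Jordan decomposition of `D` in the logarithmic derivations. -/
structure IsJordanDecomposition (D S N : Der 𝕜 n) : Prop where
  log_ss : IsLogarithmic S
  log_nilp : IsLogarithmic N
  semisimple : IsSemisimpleDer S
  nilpotent : IsNilpotentDer N
  commute : ⁅S, N⁆ = 0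
  sum : D = S + N

open Classical in
/-- The pair `(∂_ss, ∂_nilp)` of the Jordan decomposition of `∂`; by convention it is `(0, 0)` if
there is none. -/
noncomputable def jordanPair (D : Der 𝕜 n) : Der 𝕜 n × Der 𝕜 n :=
  if h : ∃ p : Der 𝕜 n × Der 𝕜 n, IsJordanDecomposition D p.1 p.2 then h.choose else 0

/-- The semi-simple component `∂_ss`. -/
noncomputable def ssPart (D : Der 𝕜 n) : Der 𝕜 n := (jordanPair D).1

/-- The nilpotent component `∂_nilp`. -/
noncomputable def nilpPart (D : Der 𝕜 n) : Der 𝕜 n := (jordanPair D).2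

theorem isJordanDecomposition_parts {D S N : Der 𝕜 n} (h : IsJordanDecomposition D S N) :
    IsJordanDecomposition D (ssPart D) (nilpPart D) := by
  have hex : ∃ p : Der 𝕜 n × Der 𝕜 n, IsJordanDecomposition D p.1 p.2 := ⟨(S, N), h⟩
  unfold ssPart nilpPart jordanPair
  rw [dif_pos hex]
  exact hex.choose_spec

/-- The coefficient `a_i` of a logarithmic derivation `∑ a_i x_i ∂/∂x_i`, that is, the series
`∂(x_i) / x_i`. -/
noncomputable def logCoeff (D : Der 𝕜 n) (i : Fin n) : Ser 𝕜 n :=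
  fun m => MvPowerSeries.coeff (m + Finsupp.single i 1) (D (MvPowerSeries.X i))

theorem IsLogarithmic.apply_X {D : Der 𝕜 n} (h : IsLogarithmic D) (i : Fin n) :
    D (MvPowerSeries.X i) = MvPowerSeries.X i * logCoeff D i := by
  have hdvd : (MvPowerSeries.X i : Ser 𝕜 n) ∣ D (MvPowerSeries.X i) := by
    have h1 : (∏ j : Fin n, (MvPowerSeries.X j : Ser 𝕜 n)) ∣
        D (∏ j : Fin n, (MvPowerSeries.X j : Ser 𝕜 n)) :=
      Ideal.mem_span_singleton.mp (h _ (Ideal.mem_span_singleton_self _))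
    have h2 := Finset.mul_prod_erase Finset.univ (fun j => (MvPowerSeries.X j : Ser 𝕜 n))
      (Finset.mem_univ i)
    rw [← h2, D.leibniz, smul_eq_mul, smul_eq_mul] at h1
    have h3 := (dvd_add_right (dvd_mul_right _ _)).mp ((dvd_mul_right _ _).trans h1)
    have hstep : ∀ (j : Fin n) (g : Ser 𝕜 n), j ≠ i →
        MvPowerSeries.X i ∣ MvPowerSeries.X j * g → MvPowerSeries.X i ∣ g := by
      intro j g hj hg
      rw [MvPowerSeries.X_dvd_iff] at hg ⊢
      intro m hm
      have h4 := hg (Finsupp.single j 1 + m) (by simp [hm, hj])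
      rwa [MvPowerSeries.X, MvPowerSeries.coeff_add_monomial_mul, one_mul] at h4
    have hprod : ∀ (s : Finset (Fin n)) (g : Ser 𝕜 n), i ∉ s →
        MvPowerSeries.X i ∣ (∏ j ∈ s, (MvPowerSeries.X j : Ser 𝕜 n)) * g →
        MvPowerSeries.X i ∣ g := by
      intro s
      induction s using Finset.induction_on with
      | empty => intro g _ hg; simpa using hg
      | insert j s hjs ih =>
        intro g his hg
        rw [Finset.prod_insert hjs, mul_assoc] at hg
        refine ih g (fun hi => his (Finset.mem_insert_of_mem hi)) (hstep j _ ?_ hg)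
        rintro rfl
        exact his (Finset.mem_insert_self _ _)
    exact hprod _ _ (Finset.notMem_erase i _) h3
  obtain ⟨g, hg⟩ := hdvd
  have hcoeff : logCoeff D i = g := by
    ext m
    change MvPowerSeries.coeff (m + Finsupp.single i 1) (D (MvPowerSeries.X i)) = _
    rw [hg, add_comm, MvPowerSeries.X, MvPowerSeries.coeff_add_monomial_mul, one_mul]
  rw [hcoeff, hg]

/-- The collinearity ideal `Γ(D ∧ E)`: the ideal generated by the coefficients
`a_i b_j - a_j b_i` of `D ∧ E` in the basis `x_i ∂/∂x_i ∧ x_j ∂/∂x_j` of the second exterior power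
of the module of logarithmic derivations. -/
noncomputable def collinearityIdeal (D E : Der 𝕜 n) : Ideal (Ser 𝕜 n) :=
  Ideal.span (Set.range fun p : Fin n × Fin n =>
    logCoeff D p.1 * logCoeff E p.2 - logCoeff D p.2 * logCoeff E p.1)

/-- The Bruno ideal `B(∂) = Γ(∂_ss ∧ ∂_nilp)`. -/
noncomputable def brunoIdeal (D : Der 𝕜 n) : Ideal (Ser 𝕜 n) :=
  collinearityIdeal (ssPart D) (nilpPart D)

/-- The diagonal derivation `L(lam) = ∑ lam_i x_i ∂/∂x_i`, acting on monomials by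
`x^m ↦ ⟨lam, m⟩ x^m`. -/
noncomputable def diagDer (lam : Fin n → 𝕜) : Der 𝕜 n :=
  Derivation.mk'
    { toFun := fun f m => (∑ i, lam i * (m i : 𝕜)) * MvPowerSeries.coeff m f
      map_add' := by
        intro f g
        funext m
        change _ * MvPowerSeries.coeff m (f + g) = _ * MvPowerSeries.coeff m f
          + _ * MvPowerSeries.coeff m g
        rw [map_add, mul_add]
      map_smul' := by
        intro c f
        funext m
        change _ * MvPowerSeries.coeff m (c • f) = c * (_ * MvPowerSeries.coeff m f)
        rw [MvPowerSeries.coeff_smul]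
        ring }
    (by
      classical
      intro f g
      ext m
      change (∑ i, lam i * (m i : 𝕜)) * MvPowerSeries.coeff m (f * g) = _
      rw [smul_eq_mul, smul_eq_mul, map_add, mul_comm g, MvPowerSeries.coeff_mul,
        MvPowerSeries.coeff_mul, MvPowerSeries.coeff_mul, ← Finset.sum_add_distrib,
        Finset.mul_sum]
      refine Finset.sum_congr rfl fun p hp => ?_
      replace hp : p.1 + p.2 = m := Finset.HasAntidiagonal.mem_antidiagonal.mp hp
      change _ = MvPowerSeries.coeff p.1 f
          * ((∑ i, lam i * (p.2 i : 𝕜)) * MvPowerSeries.coeff p.2 g)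
        + ((∑ i, lam i * (p.1 i : 𝕜)) * MvPowerSeries.coeff p.1 f) * MvPowerSeries.coeff p.2 g
      have hsum : (∑ i, lam i * (m i : 𝕜))
          = (∑ i, lam i * (p.1 i : 𝕜)) + ∑ i, lam i * (p.2 i : 𝕜) := by
        rw [← Finset.sum_add_distrib]
        refine Finset.sum_congr rfl fun i _ => ?_
        rw [← hp, Finsupp.add_apply, Nat.cast_add, mul_add]
      rw [hsum]
      ring)

/-- `∂` is an `S`-perturbation, `S = L(lam)`: it is logarithmic, and the term of its monomial
expansion `∑ x^m L(lam_m)` at `m = 0` is `L(lam)`. -/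
def IsPerturbation (lam : Fin n → 𝕜) (D : Der 𝕜 n) : Prop :=
  IsLogarithmic D ∧ ∀ i, MvPowerSeries.constantCoeff (logCoeff D i) = lam i

/-- `∂` is in normal form modulo the ideal `I`, with respect to `S = L(lam)`: the derivation `∂` is
an `S`-perturbation that has a Jordan decomposition, the ideal `I` is invariant under `∂` and `S`,
and `∂_ss` and `S` induce the same derivation on the quotient by `I`. -/
structure IsNormalFormModulo (lam : Fin n → 𝕜) (D : Der 𝕜 n) (I : Ideal (Ser 𝕜 n)) : Prop where
  perturbation : IsPerturbation lam D
  jordan : IsJordanDecomposition D (ssPart D) (nilpPart D)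
  invariant : IsInvariant D I
  eq_quotient : ∃ (hss : IsInvariant (ssPart D) I) (hS : IsInvariant (diagDer lam) I),
    quotientDer (ssPart D) I hss = quotientDer (diagDer lam) I hS

/-- The conjugate `Φ ∂ Φ⁻¹` of a derivation by a formal automorphism. -/
noncomputable def conj (Φ : Ser 𝕜 n ≃ₐ[𝕜] Ser 𝕜 n) (D : Der 𝕜 n) : Der 𝕜 n :=
  Derivation.mk' (Φ.toLinearMap ∘ₗ (D : Ser 𝕜 n →ₗ[𝕜] Ser 𝕜 n) ∘ₗ Φ.symm.toLinearMap) (by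
    intro a b
    simp [Derivation.leibniz])

theorem conj_apply (Φ : Ser 𝕜 n ≃ₐ[𝕜] Ser 𝕜 n) (D : Der 𝕜 n) (f : Ser 𝕜 n) :
    conj Φ D f = Φ (D (Φ.symm f)) := rfl

end LogDer

namespace LogDer

variable {𝕜 : Type*} [RCLike 𝕜] {n : ℕ}

/-! Take for `lam` the constant terms of the logarithmic coefficients of `D`, and write L = `diagDer
lam`. For formal series there are no small divisors to control: every nonresonant monomial can be
removed, so the Poincaré–Dulac theorem holds for every `lam`. A substitution x_i ↦ x_i(1 + v_i),
which respects the coordinate hyperplanes, carries `D` to L + N, where N has resonant logarithmic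
coefficients b_i vanishing at the origin. L is semi-simple because it is diagonal on monomials, N is
nilpotent because it raises the order, and they commute; by uniqueness of the Jordan decomposition
they are the semi-simple and nilpotent parts of the conjugate.

Hence the semi-simple part equals L exactly, not only modulo the Bruno ideal. What remains is the
invariance of that ideal, generated by γ_ij = lam_i b_j - lam_j b_i. L kills these generators, and N
preserves the ideal because lam_i N and b_i L agree modulo it.

The analytic substitute is a contraction principle for the 𝔪-adic topology (`exists_fixedPoint`). It
solves the whole nonlinear homological equation at once (`exists_normalizing`), and it also inverts
the coordinate change (`algHom_bijective`). -/

/-! ### The 𝔪-adic filtration, derivations and endomorphisms. -/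

theorem X_mem_maxIdeal (i : Fin n) : (MvPowerSeries.X i : Ser 𝕜 n) ∈ maxIdeal 𝕜 n :=
  Ideal.subset_span ⟨i, rfl⟩

/-- The `𝔪`-adic filtration is the filtration by the order. -/
theorem mem_maxIdeal_pow_iff {k : ℕ} {f : Ser 𝕜 n} :
    f ∈ maxIdeal 𝕜 n ^ k ↔ ∀ m : Fin n →₀ ℕ, m.degree < k → MvPowerSeries.coeff m f = 0 := by
  classical
  constructor
  · intro hf
    suffices (k : ℕ∞) ≤ f.order from fun m hm =>
      MvPowerSeries.coeff_of_lt_order (lt_of_lt_of_le (by exact_mod_cast hm) this)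
    have h1 : ∀ g ∈ maxIdeal 𝕜 n, MvPowerSeries.constantCoeff g = 0 := by
      intro g hg
      have hle : maxIdeal 𝕜 n ≤ RingHom.ker (MvPowerSeries.constantCoeff (σ := Fin n) (R := 𝕜)) := by
        rw [maxIdeal, Ideal.span_le]
        rintro _ ⟨i, rfl⟩
        simp [RingHom.mem_ker]
      exact hle hg
    induction k generalizing f with
    | zero => simp
    | succ k ih =>
      rw [pow_succ] at hf
      refine Submodule.mul_induction_on hf (fun a ha b hb => ?_) (fun a b ha hb => ?_)
      · refine le_trans ?_ MvPowerSeries.le_order_mul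
        push_cast
        exact add_le_add (ih ha) (MvPowerSeries.one_le_order_iff_constCoeff_eq_zero.mpr (h1 b hb))
      · exact le_trans (le_min ha hb) MvPowerSeries.min_order_le_add
  · induction k generalizing f with
    | zero => simp
    | succ k ih =>
      intro hf
      have hne : ∀ m : Fin n →₀ ℕ, MvPowerSeries.coeff m f ≠ 0 → ∃ i, m i ≠ 0 := by
        intro m hm
        by_contra! h
        have h0 : m = 0 := Finsupp.ext h
        exact hm (hf m (by simp [h0]))
      rcases isEmpty_or_nonempty (Fin n) with hE | hE
      · have h0 : f = 0 := by
          ext m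
          by_contra h
          exact hE.elim (hne m h).choose
        rw [h0]
        exact zero_mem _
      -- Each monomial of `f` is assigned one variable dividing it, which splits `f` into multiples
      -- of the single variables. The choice needs a variable to exist, hence the separate case n =
      -- 0.
      choose! idx hidx using hne
      let part : Fin n → Ser 𝕜 n := fun i m => if idx m = i then MvPowerSeries.coeff m f else 0
      have hcoeff : ∀ i m, MvPowerSeries.coeff m (part i)
          = if idx m = i then MvPowerSeries.coeff m f else 0 := fun _ _ => rfl
      have hsum : f = ∑ i, part i := by
        ext m
        rw [map_sum]
        simp [hcoeff]
      rw [hsum]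
      refine Ideal.sum_mem _ fun i _ => ?_
      have hdvd : (MvPowerSeries.X i : Ser 𝕜 n) ∣ part i := by
        rw [MvPowerSeries.X_dvd_iff]
        intro m hm
        rw [hcoeff]
        split_ifs with h
        · by_contra h2
          exact hidx m h2 (h ▸ hm)
        · rfl
      obtain ⟨g, hg⟩ := hdvd
      rw [hg, pow_succ, mul_comm (MvPowerSeries.X i)]
      refine Ideal.mul_mem_mul (ih fun m hm => ?_) (X_mem_maxIdeal i)
      have h2 : MvPowerSeries.coeff (Finsupp.single i 1 + m) (part i)
          = MvPowerSeries.coeff m g := by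
        rw [hg, MvPowerSeries.X, MvPowerSeries.coeff_add_monomial_mul, one_mul]
      rw [← h2, hcoeff, hf _ (by rw [map_add, Finsupp.degree_single]; omega), ite_self]

theorem mem_maxIdeal_iff {f : Ser 𝕜 n} :
    f ∈ maxIdeal 𝕜 n ↔ MvPowerSeries.constantCoeff f = 0 := by
  rw [← pow_one (maxIdeal 𝕜 n), mem_maxIdeal_pow_iff]
  constructor
  · intro h
    exact h 0 (by simp)
  · intro h m hm
    have : m = 0 := (Finsupp.degree_eq_zero_iff m).mp (by omega)
    rw [this]
    exact h

theorem sub_C_mem_maxIdeal (f : Ser 𝕜 n) :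
    f - MvPowerSeries.C (MvPowerSeries.constantCoeff f) ∈ maxIdeal 𝕜 n := by
  simp [mem_maxIdeal_iff]

theorem eq_zero_of_forall_mem_pow {f : Ser 𝕜 n} (h : ∀ k, f ∈ maxIdeal 𝕜 n ^ k) : f = 0 := by
  ext m
  exact mem_maxIdeal_pow_iff.mp (h (m.degree + 1)) m (Nat.lt_succ_self _)

theorem exists_sub_coe_mem_pow (f : Ser 𝕜 n) (k : ℕ) :
    ∃ p : MvPolynomial (Fin n) 𝕜, f - (p : Ser 𝕜 n) ∈ maxIdeal 𝕜 n ^ k := by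
  refine ⟨MvPowerSeries.truncTotal k f, mem_maxIdeal_pow_iff.mpr fun m hm => ?_⟩
  rw [map_sub, MvPolynomial.coeff_coe, MvPowerSeries.coeff_truncTotal _ hm, sub_self]

/-- A derivation that sends the variables to `𝔪` is local. -/
theorem isLocalDer_of_X {D : Der 𝕜 n} (h : ∀ i, D (MvPowerSeries.X i) ∈ maxIdeal 𝕜 n) :
    IsLocalDer D := by
  intro f hf
  refine Submodule.span_induction (p := fun f _ => D f ∈ maxIdeal 𝕜 n) ?_ (by simp) ?_ ?_ hf
  · rintro _ ⟨i, rfl⟩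
    exact h i
  · intro a b _ _ ha hb
    rw [map_add]
    exact Ideal.add_mem _ ha hb
  · intro a b hb hDb
    rw [smul_eq_mul, D.leibniz, smul_eq_mul, smul_eq_mul]
    exact Ideal.add_mem _ (Ideal.mul_mem_left _ _ hDb) (Ideal.mul_mem_right _ _ hb)

theorem der_coe_eq_zero {D : Der 𝕜 n} (h : ∀ i, D (MvPowerSeries.X i) = 0)
    (p : MvPolynomial (Fin n) 𝕜) : D (p : Ser 𝕜 n) = 0 := by
  induction p using MvPolynomial.induction_on with
  | C a =>
    rw [MvPolynomial.coe_C]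
    exact D.map_algebraMap a
  | add p q hp hq => rw [MvPolynomial.coe_add, map_add, hp, hq, add_zero]
  | mul_X p i hp => rw [MvPolynomial.coe_mul, MvPolynomial.coe_X, D.leibniz, hp, h]; simp

/-- A derivation of the power series ring is determined by the images of the variables. -/
theorem der_ext {D E : Der 𝕜 n} (h : ∀ i, D (MvPowerSeries.X i) = E (MvPowerSeries.X i)) :
    D = E := by
  rw [← sub_eq_zero]
  have h0 : ∀ i, (D - E) (MvPowerSeries.X i) = 0 := fun i => by
    rw [Derivation.sub_apply, h, sub_self]
  have hloc : IsLocalDer (D - E) := isLocalDer_of_X fun i => by rw [h0]; exact zero_mem _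
  ext f : 1
  refine eq_zero_of_forall_mem_pow fun k => ?_
  obtain ⟨p, hp⟩ := exists_sub_coe_mem_pow f k
  have := hloc.pow k _ hp
  rwa [map_sub, der_coe_eq_zero h0, sub_zero] at this

theorem IsLogarithmic.isLocalDer {D : Der 𝕜 n} (h : IsLogarithmic D) : IsLocalDer D :=
  isLocalDer_of_X fun i => by
    rw [h.apply_X]
    exact Ideal.mul_mem_right _ _ (X_mem_maxIdeal i)

/-- Logarithmic derivatives add: the product of the variables is multiplied by the sum of the `a i`.
-/
theorem isLogarithmic_of_apply_X {D : Der 𝕜 n} {a : Fin n → Ser 𝕜 n}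
    (h : ∀ i, D (MvPowerSeries.X i) = MvPowerSeries.X i * a i) : IsLogarithmic D := by
  classical
  have hprod : ∀ s : Finset (Fin n), D (∏ i ∈ s, (MvPowerSeries.X i : Ser 𝕜 n))
      = (∏ i ∈ s, (MvPowerSeries.X i : Ser 𝕜 n)) * ∑ i ∈ s, a i := by
    intro s
    induction s using Finset.induction_on with
    | empty => simp
    | insert j s hj ih =>
      rw [Finset.prod_insert hj, Finset.sum_insert hj, D.leibniz, ih, h, smul_eq_mul, smul_eq_mul]
      ring
  intro f hf
  obtain ⟨g, rfl⟩ := Ideal.mem_span_singleton.mp hf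
  rw [D.leibniz, hprod, smul_eq_mul, smul_eq_mul]
  exact Ideal.mem_span_singleton.mpr
    (dvd_add (dvd_mul_right _ _) (Dvd.dvd.mul_left (dvd_mul_right _ _) _))

theorem logCoeff_eq {D : Der 𝕜 n} {i : Fin n} {a : Ser 𝕜 n}
    (h : D (MvPowerSeries.X i) = MvPowerSeries.X i * a) : logCoeff D i = a := by
  ext m
  change MvPowerSeries.coeff (m + Finsupp.single i 1) (D (MvPowerSeries.X i)) = _
  rw [h, add_comm, MvPowerSeries.X, MvPowerSeries.coeff_add_monomial_mul, one_mul]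

/-- A derivation that raises the order of the variables raises the order of every series. -/
theorem der_mem_pow_succ {D : Der 𝕜 n} (h : ∀ i, D (MvPowerSeries.X i) ∈ maxIdeal 𝕜 n ^ 2)
    {k : ℕ} {f : Ser 𝕜 n} (hf : f ∈ maxIdeal 𝕜 n ^ k) : D f ∈ maxIdeal 𝕜 n ^ (k + 1) := by
  have hloc : IsLocalDer D := isLocalDer_of_X fun i => Ideal.pow_le_self two_ne_zero (h i)
  have h0 : ∀ f, D f ∈ maxIdeal 𝕜 n := by
    intro f
    have := hloc _ (sub_C_mem_maxIdeal f)
    rwa [map_sub, show D (MvPowerSeries.C (MvPowerSeries.constantCoeff f)) = 0 from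
      D.map_algebraMap _, sub_zero] at this
  have h1 : ∀ f ∈ maxIdeal 𝕜 n, D f ∈ maxIdeal 𝕜 n ^ 2 := by
    intro f hf
    refine Submodule.span_induction (p := fun f _ => D f ∈ maxIdeal 𝕜 n ^ 2) ?_ (by simp) ?_ ?_ hf
    · rintro _ ⟨i, rfl⟩
      exact h i
    · intro a b _ _ ha hb
      rw [map_add]
      exact Ideal.add_mem _ ha hb
    · intro a b hb hDb
      rw [smul_eq_mul, D.leibniz, smul_eq_mul, smul_eq_mul]
      refine Ideal.add_mem _ (Ideal.mul_mem_left _ _ hDb) ?_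
      rw [pow_two]
      exact Ideal.mul_mem_mul hb (h0 a)
  induction k generalizing f with
  | zero => simpa using h0 f
  | succ k ih =>
    rw [pow_succ] at hf
    refine Submodule.mul_induction_on hf (fun a ha b hb => ?_) (fun a b ha hb => ?_)
    · rw [D.leibniz, smul_eq_mul, smul_eq_mul]
      refine Ideal.add_mem _ ?_ ?_
      · rw [show k + 1 + 1 = k + 2 from rfl, pow_add]
        exact Ideal.mul_mem_mul ha (h1 b hb)
      · rw [pow_succ', pow_succ' _ k, ← pow_succ']
        exact Ideal.mul_mem_mul hb (ih ha)
    · rw [map_add]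
      exact Ideal.add_mem _ ha hb

theorem algHom_mem_pow {F : Ser 𝕜 n →ₐ[𝕜] Ser 𝕜 n}
    (hF : ∀ i, F (MvPowerSeries.X i) ∈ maxIdeal 𝕜 n) {k : ℕ} {f : Ser 𝕜 n}
    (hf : f ∈ maxIdeal 𝕜 n ^ k) : F f ∈ maxIdeal 𝕜 n ^ k := by
  have hle : (maxIdeal 𝕜 n).map F ≤ maxIdeal 𝕜 n := by
    rw [maxIdeal, Ideal.map_span, Ideal.span_le]
    rintro _ ⟨_, ⟨i, rfl⟩, rfl⟩
    exact hF i
  have h1 := Ideal.mem_map_of_mem F hf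
  rw [Ideal.map_pow] at h1
  exact Ideal.pow_right_mono hle k h1

/-- Local endomorphisms that agree on the variables modulo `𝔪^k` agree modulo `𝔪^k`. -/
theorem algHom_sub_mem_pow {F G : Ser 𝕜 n →ₐ[𝕜] Ser 𝕜 n}
    (hF : ∀ i, F (MvPowerSeries.X i) ∈ maxIdeal 𝕜 n)
    (hG : ∀ i, G (MvPowerSeries.X i) ∈ maxIdeal 𝕜 n) {k : ℕ}
    (h : ∀ i, F (MvPowerSeries.X i) - G (MvPowerSeries.X i) ∈ maxIdeal 𝕜 n ^ k) (f : Ser 𝕜 n) :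
    F f - G f ∈ maxIdeal 𝕜 n ^ k := by
  have hpoly : ∀ p : MvPolynomial (Fin n) 𝕜,
      F (p : Ser 𝕜 n) - G (p : Ser 𝕜 n) ∈ maxIdeal 𝕜 n ^ k := by
    intro p
    induction p using MvPolynomial.induction_on with
    | C a =>
      rw [MvPolynomial.coe_C, show (MvPowerSeries.C a : Ser 𝕜 n) = algebraMap 𝕜 _ a from rfl,
        AlgHom.commutes, AlgHom.commutes, sub_self]
      exact zero_mem _
    | add p q hp hq =>
      rw [MvPolynomial.coe_add, map_add, map_add, add_sub_add_comm]
      exact Ideal.add_mem _ hp hq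
    | mul_X p i hp =>
      rw [MvPolynomial.coe_mul, MvPolynomial.coe_X, map_mul, map_mul]
      rw [show ∀ a b c d : Ser 𝕜 n, a * b - c * d = (a - c) * b + c * (b - d) from
        fun a b c d => by ring]
      exact Ideal.add_mem _ (Ideal.mul_mem_right _ _ hp) (Ideal.mul_mem_left _ _ (h i))
  obtain ⟨p, hp⟩ := exists_sub_coe_mem_pow f k
  have h1 := Ideal.add_mem _ (Ideal.sub_mem _ (algHom_mem_pow hF hp) (algHom_mem_pow hG hp))
    (hpoly p)
  rw [map_sub, map_sub] at h1
  convert h1 using 1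
  ring

/-- An endomorphism that is the identity on `𝔪 / 𝔪^2` is the identity on `𝔪^k / 𝔪^{k+1}`. -/
theorem algHom_sub_self_mem_pow {F : Ser 𝕜 n →ₐ[𝕜] Ser 𝕜 n}
    (hF : ∀ i, F (MvPowerSeries.X i) - MvPowerSeries.X i ∈ maxIdeal 𝕜 n ^ 2) {k : ℕ}
    {f : Ser 𝕜 n} (hf : f ∈ maxIdeal 𝕜 n ^ k) : F f - f ∈ maxIdeal 𝕜 n ^ (k + 1) := by
  have hloc : ∀ i, F (MvPowerSeries.X i) ∈ maxIdeal 𝕜 n := fun i => by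
    have := Ideal.add_mem _ (Ideal.pow_le_self two_ne_zero (hF i)) (X_mem_maxIdeal i)
    rwa [sub_add_cancel] at this
  have h0 : ∀ f, F f - f ∈ maxIdeal 𝕜 n := by
    intro f
    have := algHom_sub_mem_pow (k := 1) hloc (G := AlgHom.id 𝕜 _) X_mem_maxIdeal
      (fun i => by simpa using Ideal.pow_le_self two_ne_zero (hF i)) f
    simpa using this
  have h1 : ∀ f, F f - f ∈ maxIdeal 𝕜 n ^ 2 := fun f =>
    algHom_sub_mem_pow hloc (G := AlgHom.id 𝕜 _) X_mem_maxIdeal hF f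
  induction k generalizing f with
  | zero => simpa using h0 f
  | succ k ih =>
    rw [pow_succ] at hf
    refine Submodule.mul_induction_on hf (fun a ha b hb => ?_) (fun a b ha hb => ?_)
    · rw [map_mul, show F a * F b - a * b = (F a - a) * F b + a * (F b - b) by ring]
      refine Ideal.add_mem _ ?_ ?_
      · rw [pow_succ]
        refine Ideal.mul_mem_mul (ih ha) ?_
        have := algHom_mem_pow (k := 1) hloc (by simpa using hb)
        simpa using this
      · rw [show k + 1 + 1 = k + 2 from rfl, pow_add]
        exact Ideal.mul_mem_mul ha (h1 b)
    · rw [map_add, add_sub_add_comm]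
      exact Ideal.add_mem _ ha hb

/-! ### Contractions and inversion of coordinate changes. -/

/-- Fixed points of contractions for the `𝔪`-adic topology, on tuples of elements of `𝔪^a`. -/
theorem exists_fixedPoint {ι : Type*} (a : ℕ) (G : (ι → Ser 𝕜 n) → ι → Ser 𝕜 n)
    (hmem : ∀ z, (∀ i, z i ∈ maxIdeal 𝕜 n ^ a) → ∀ i, G z i ∈ maxIdeal 𝕜 n ^ a)
    (hcontr : ∀ k, a ≤ k → ∀ z w, (∀ i, z i ∈ maxIdeal 𝕜 n ^ a) →
      (∀ i, w i ∈ maxIdeal 𝕜 n ^ a) → (∀ i, z i - w i ∈ maxIdeal 𝕜 n ^ k) →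
      ∀ i, G z i - G w i ∈ maxIdeal 𝕜 n ^ (k + 1)) :
    ∃ z, (∀ i, z i ∈ maxIdeal 𝕜 n ^ a) ∧ G z = z := by
  let s : ℕ → ι → Ser 𝕜 n := fun j => G^[j] 0
  have hs : ∀ j, s (j + 1) = G (s j) := fun j => Function.iterate_succ_apply' G j 0
  have hsmem : ∀ j i, s j i ∈ maxIdeal 𝕜 n ^ a := by
    intro j
    induction j with
    | zero => intro i; exact zero_mem _
    | succ j ih => rw [hs]; exact hmem _ ih
  have hstep : ∀ j i, s (j + 1) i - s j i ∈ maxIdeal 𝕜 n ^ (a + j) := by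
    intro j
    induction j with
    | zero => exact fun i => Ideal.sub_mem _ (hsmem 1 i) (hsmem 0 i)
    | succ j ih =>
      rw [hs (j + 1)]
      nth_rewrite 2 [hs j]
      exact hcontr _ (Nat.le_add_right _ _) _ _ (hsmem _) (hsmem _) ih
  have hcauchy : ∀ j d i, s (j + d) i - s j i ∈ maxIdeal 𝕜 n ^ (a + j) := by
    intro j d i
    induction d with
    | zero => simp
    | succ d ih =>
      rw [← sub_add_sub_cancel _ (s (j + d) i) _]
      exact Ideal.add_mem _ (Ideal.pow_le_pow_right (by omega) (hstep (j + d) i)) ih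
  -- A coefficient of degree d no longer changes from the iterate d + 1 on, so the limit reads it
  -- there.
  let z : ι → Ser 𝕜 n := fun i m => MvPowerSeries.coeff m (s (m.degree + 1) i)
  have hz : ∀ j i, z i - s j i ∈ maxIdeal 𝕜 n ^ j := by
    intro j i
    refine mem_maxIdeal_pow_iff.mpr fun m hm => ?_
    rw [map_sub, show MvPowerSeries.coeff m (z i) = MvPowerSeries.coeff m (s (m.degree + 1) i)
      from rfl]
    obtain ⟨d, rfl⟩ := Nat.exists_eq_add_of_le (Nat.succ_le_of_lt hm)
    rw [← map_sub, ← neg_sub, map_neg, neg_eq_zero]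
    exact mem_maxIdeal_pow_iff.mp (hcauchy (m.degree + 1) d i) m (by omega)
  have hzmem : ∀ i, z i ∈ maxIdeal 𝕜 n ^ a := fun i => by
    simpa using Ideal.add_mem _ (hz a i) (hsmem a i)
  refine ⟨z, hzmem, ?_⟩
  funext i
  rw [← sub_eq_zero]
  refine eq_zero_of_forall_mem_pow fun k => ?_
  have h1 := hcontr (a + k) (Nat.le_add_right _ _) _ _ hzmem (hsmem _) (hz (a + k)) i
  rw [← hs] at h1
  have h2 := Ideal.sub_mem _ h1 (hz (a + k + 1) i)
  rw [sub_sub_sub_cancel_right] at h2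
  exact Ideal.pow_le_pow_right (by omega) h2

/-- Since F - id raises the order, an element of the kernel lies in every power of 𝔪, and z ↦ g - (F
z - z) is a contraction whose fixed point is a preimage of g. -/
theorem algHom_bijective {F : Ser 𝕜 n →ₐ[𝕜] Ser 𝕜 n}
    (hF : ∀ i, F (MvPowerSeries.X i) - MvPowerSeries.X i ∈ maxIdeal 𝕜 n ^ 2) :
    Function.Bijective F := by
  constructor
  · rw [injective_iff_map_eq_zero]
    intro f hf
    refine eq_zero_of_forall_mem_pow fun k => ?_
    induction k with
    | zero => simp
    | succ k ih => simpa [hf] using algHom_sub_self_mem_pow hF ih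
  · intro g
    obtain ⟨z, -, hz⟩ := exists_fixedPoint 0 (fun (z : Unit → Ser 𝕜 n) _ => g - (F (z ()) - z ()))
      (fun z _ i => by simp) (fun k _ z w _ _ h i => by
        have := algHom_sub_self_mem_pow hF (h ())
        rw [map_sub, ← neg_mem_iff] at this
        convert this using 1
        ring)
    refine ⟨z (), ?_⟩
    have := congrFun hz ()
    linear_combination -this

/-! ### Operators diagonal on monomials. -/

theorem coeff_diagDer (lam : Fin n → 𝕜) (m : Fin n →₀ ℕ) (f : Ser 𝕜 n) :
    MvPowerSeries.coeff m (diagDer lam f) = (∑ i, lam i * (m i : 𝕜)) * MvPowerSeries.coeff m f :=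
  rfl

theorem diagDer_X (lam : Fin n → 𝕜) (i : Fin n) :
    diagDer lam (MvPowerSeries.X i) = MvPowerSeries.X i * MvPowerSeries.C (lam i) := by
  classical
  ext m
  rw [coeff_diagDer, MvPowerSeries.coeff_mul_C, MvPowerSeries.coeff_X]
  split_ifs with h
  · rw [h]
    simp [Finsupp.single_apply]
  · simp

theorem diagDer_C (lam : Fin n → 𝕜) (c : 𝕜) :
    diagDer lam (MvPowerSeries.C c) = 0 :=
  (diagDer lam).map_algebraMap c

/-- The linear operator that multiplies the monomial `x^m` by `c m`. -/
def diagOp (c : (Fin n →₀ ℕ) → 𝕜) : Ser 𝕜 n →ₗ[𝕜] Ser 𝕜 n where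
  toFun f m := c m * MvPowerSeries.coeff m f
  map_add' f g := by
    funext m
    exact mul_add _ _ _
  map_smul' r f := by
    funext m
    exact mul_left_comm _ _ _

theorem coeff_diagOp (c : (Fin n →₀ ℕ) → 𝕜) (m : Fin n →₀ ℕ) (f : Ser 𝕜 n) :
    MvPowerSeries.coeff m (diagOp c f) = c m * MvPowerSeries.coeff m f := rfl

theorem diagOp_mem_pow (c : (Fin n →₀ ℕ) → 𝕜) {k : ℕ} {f : Ser 𝕜 n}
    (hf : f ∈ maxIdeal 𝕜 n ^ k) : diagOp c f ∈ maxIdeal 𝕜 n ^ k :=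
  mem_maxIdeal_pow_iff.mpr fun m hm => by
    rw [coeff_diagOp, mem_maxIdeal_pow_iff.mp hf m hm, mul_zero]

theorem isLogarithmic_diagDer (lam : Fin n → 𝕜) : IsLogarithmic (diagDer lam) :=
  isLogarithmic_of_apply_X (diagDer_X lam)

theorem logCoeff_diagDer (lam : Fin n → 𝕜) (i : Fin n) :
    logCoeff (diagDer lam) i = MvPowerSeries.C (lam i) :=
  logCoeff_eq (diagDer_X lam i)

/-! ### Jet spaces and the Jordan decomposition. -/

/-- The coefficients of order at most `k` of a `k`-jet. -/
noncomputable def jetCoeff (𝕜 : Type*) [RCLike 𝕜] (n k : ℕ) :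
    (Ser 𝕜 n ⧸ maxIdeal 𝕜 n ^ (k + 1)) →ₗ[𝕜] {m : Fin n →₀ ℕ // m.degree < k + 1} → 𝕜 :=
  Submodule.liftQ ((maxIdeal 𝕜 n ^ (k + 1)).restrictScalars 𝕜)
    (LinearMap.pi fun m => MvPowerSeries.coeff m.1) (fun f hf => by
      rw [LinearMap.mem_ker]
      funext m
      exact mem_maxIdeal_pow_iff.mp hf m.1 m.2)

theorem jetCoeff_injective (k : ℕ) : Function.Injective (jetCoeff 𝕜 n k) := by
  rw [injective_iff_map_eq_zero]
  intro f hf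
  obtain ⟨f, rfl⟩ := Ideal.Quotient.mk_surjective f
  exact Ideal.Quotient.eq_zero_iff_mem.mpr
    (mem_maxIdeal_pow_iff.mpr fun m hm => congrFun hf ⟨m, hm⟩)

instance jet_finite (k : ℕ) : Module.Finite 𝕜 (Ser 𝕜 n ⧸ maxIdeal 𝕜 n ^ (k + 1)) := by
  have : Finite {m : Fin n →₀ ℕ // m.degree < k + 1} := Finsupp.finite_of_degree_lt (k + 1)
  exact Module.Finite.of_injective _ (jetCoeff_injective k)

theorem jetEnd_mk (D : Der 𝕜 n) (h : IsLocalDer D) (k : ℕ) (f : Ser 𝕜 n) :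
    jetEnd D h k (Ideal.Quotient.mk _ f) = Ideal.Quotient.mk _ (D f) := rfl

theorem jetEnd_ext {k : ℕ} {F G : Module.End 𝕜 (Ser 𝕜 n ⧸ maxIdeal 𝕜 n ^ (k + 1))}
    (h : ∀ f, F (Ideal.Quotient.mk _ f) = G (Ideal.Quotient.mk _ f)) : F = G := by
  refine LinearMap.ext fun f => ?_
  obtain ⟨f, rfl⟩ := Ideal.Quotient.mk_surjective f
  exact h f

theorem isSemisimpleDer_diagDer (lam : Fin n → 𝕜) : IsSemisimpleDer (diagDer lam) := by
  classical
  refine ⟨(isLogarithmic_diagDer lam).isLocalDer, fun k => ?_⟩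
  have : Finite {m : Fin n →₀ ℕ // m.degree < k + 1} := Finsupp.finite_of_degree_lt (k + 1)
  have := Fintype.ofFinite {m : Fin n →₀ ℕ // m.degree < k + 1}
  let w : {m : Fin n →₀ ℕ // m.degree < k + 1} → 𝕜 := fun m => ∑ i, lam i * (m.1 i : 𝕜)
  -- The product runs over the set of weights, each counted once, so `p` is squarefree; it
  -- annihilates the jet endomorphism because a polynomial q acts on the coefficient of x^m as q(w
  -- m).
  let p : Polynomial 𝕜 := ∏ c ∈ Finset.univ.image w, (Polynomial.X - Polynomial.C c)
  have hp : Squarefree p :=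
    (Polynomial.separable_prod_X_sub_C_iff'.mpr fun _ _ _ _ h => h).squarefree
  refine Module.End.isSemisimple_of_squarefree_aeval_eq_zero hp ?_
  have hq : ∀ (q : Polynomial 𝕜) (v : Ser 𝕜 n ⧸ maxIdeal 𝕜 n ^ (k + 1))
      (m : {m : Fin n →₀ ℕ // m.degree < k + 1}),
      jetCoeff 𝕜 n k (Polynomial.aeval (jetEnd _ (isLogarithmic_diagDer lam).isLocalDer k) q v) m
        = q.eval (w m) * jetCoeff 𝕜 n k v m := by
    intro q
    induction q using Polynomial.induction_on with
    | C a => intro v m; simp [Module.algebraMap_end_apply]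
    | add p q hp hq => intro v m; simp [hp, hq, add_mul]
    | monomial j a ih =>
      intro v m
      rw [pow_succ Polynomial.X j, ← mul_assoc, map_mul, Module.End.mul_apply, ih, Polynomial.aeval_X,
        Polynomial.eval_mul (p := _ * _), Polynomial.eval_X, mul_assoc _ (w m)]
      congr 1
      obtain ⟨f, rfl⟩ := Ideal.Quotient.mk_surjective v
      rfl
  refine LinearMap.ext fun v => jetCoeff_injective k ?_
  funext m
  rw [hq, Polynomial.eval_prod, Finset.prod_eq_zero (Finset.mem_image_of_mem w (Finset.mem_univ m))
    (by simp), zero_mul]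
  simp

/-- Each application raises the order by one, so k + 1 applications vanish on k-jets. -/
theorem isNilpotentDer_of_X {D : Der 𝕜 n} (h : ∀ i, D (MvPowerSeries.X i) ∈ maxIdeal 𝕜 n ^ 2) :
    IsNilpotentDer D := by
  refine ⟨isLocalDer_of_X fun i => Ideal.pow_le_self two_ne_zero (h i), fun k => ⟨k + 1, ?_⟩⟩
  have hj : ∀ (j : ℕ) (f : Ser 𝕜 n), ∃ g ∈ maxIdeal 𝕜 n ^ j,
      (jetEnd D (isLocalDer_of_X fun i => Ideal.pow_le_self two_ne_zero (h i)) k ^ j)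
        (Ideal.Quotient.mk _ f) = Ideal.Quotient.mk _ g := by
    intro j f
    induction j with
    | zero => exact ⟨f, by simp, rfl⟩
    | succ j ih =>
      obtain ⟨g, hg, hfg⟩ := ih
      exact ⟨D g, der_mem_pow_succ h hg, by
        rw [pow_succ' _ j, Module.End.mul_apply, hfg, jetEnd_mk]⟩
  refine jetEnd_ext fun f => ?_
  obtain ⟨g, hg, hfg⟩ := hj (k + 1) f
  rw [hfg, LinearMap.zero_apply]
  exact Ideal.Quotient.eq_zero_iff_mem.mpr hg

/-- Uniqueness of the Jordan decomposition. -/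
theorem IsJordanDecomposition.unique {D S N S' N' : Der 𝕜 n} (h : IsJordanDecomposition D S N)
    (h' : IsJordanDecomposition D S' N') : S = S' ∧ N = N' := by
  have hcomm : ∀ {S N : Der 𝕜 n} (hS : IsLocalDer S) (hN : IsLocalDer N) (_ : ⁅S, N⁆ = 0) (k : ℕ),
      Commute (jetEnd N hN k) (jetEnd S hS k) := by
    intro S N hS hN hc k
    refine jetEnd_ext fun f => ?_
    have := congrArg (fun E : Der 𝕜 n => E f) hc
    simp only [Derivation.commutator_apply, Derivation.zero_apply, sub_eq_zero] at this
    rw [Module.End.mul_apply, Module.End.mul_apply, jetEnd_mk, jetEnd_mk, jetEnd_mk, jetEnd_mk,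
      this]
  obtain ⟨hS, hSs⟩ := h.semisimple
  obtain ⟨hN, hNn⟩ := h.nilpotent
  obtain ⟨hS', hSs'⟩ := h'.semisimple
  obtain ⟨hN', hNn'⟩ := h'.nilpotent
  have hsum : S + N = S' + N' := h.sum.symm.trans h'.sum
  have hSS : S = S' := by
    ext f : 1
    rw [← sub_eq_zero]
    refine eq_zero_of_forall_mem_pow fun k => ?_
    -- Uniqueness is inherited from linear algebra on every jet space; the intersection of the
    -- powers of 𝔪 is zero.
    have hk := (Module.End.isNilpotent_isSemisimple_unique (hNn k) (hSs k) (hNn' k) (hSs' k)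
      (hcomm hS hN h.commute k) (hcomm hS' hN' h'.commute k) (jetEnd_ext fun f => by
        rw [LinearMap.add_apply, LinearMap.add_apply, jetEnd_mk, jetEnd_mk, jetEnd_mk, jetEnd_mk,
          ← map_add, ← map_add, ← Derivation.add_apply, ← Derivation.add_apply, add_comm N, hsum,
          add_comm S'])).2
    have h1 := congrArg (fun F => F (Ideal.Quotient.mk _ f)) hk
    simp only [jetEnd_mk] at h1
    exact Ideal.pow_le_pow_right (Nat.le_succ k) (Ideal.Quotient.eq.mp h1)
  exact ⟨hSS, by rw [hSS] at hsum; exact add_left_cancel hsum⟩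

theorem IsJordanDecomposition.ssPart_eq {D S N : Der 𝕜 n} (h : IsJordanDecomposition D S N) :
    ssPart D = S :=
  ((isJordanDecomposition_parts h).unique h).1

theorem IsJordanDecomposition.nilpPart_eq {D S N : Der 𝕜 n} (h : IsJordanDecomposition D S N) :
    nilpPart D = N :=
  ((isJordanDecomposition_parts h).unique h).2

/-! ### The homological equation and the normal form. -/

theorem hasSubst_mul_X (u : Fin n → Ser 𝕜 n) :
    MvPowerSeries.HasSubst fun i => (MvPowerSeries.X i : Ser 𝕜 n) * u i :=
  MvPowerSeries.hasSubst_of_constantCoeff_zero fun i => by simp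

/-- The endomorphism `x_i ↦ x_i u_i` of the power series ring. -/
noncomputable def mulHom (u : Fin n → Ser 𝕜 n) : Ser 𝕜 n →ₐ[𝕜] Ser 𝕜 n :=
  MvPowerSeries.substAlgHom (hasSubst_mul_X u)

theorem mulHom_X (u : Fin n → Ser 𝕜 n) (i : Fin n) :
    mulHom u (MvPowerSeries.X i) = MvPowerSeries.X i * u i :=
  MvPowerSeries.substAlgHom_X (hasSubst_mul_X u) i

theorem mulHom_X_mem (u : Fin n → Ser 𝕜 n) (i : Fin n) :
    mulHom u (MvPowerSeries.X i) ∈ maxIdeal 𝕜 n := by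
  rw [mulHom_X]
  exact Ideal.mul_mem_right _ _ (X_mem_maxIdeal i)

theorem mulHom_X_sub_X_mem {v : Fin n → Ser 𝕜 n} (hv : ∀ i, v i ∈ maxIdeal 𝕜 n) (i : Fin n) :
    mulHom (fun i => 1 + v i) (MvPowerSeries.X i) - MvPowerSeries.X i ∈ maxIdeal 𝕜 n ^ 2 := by
  rw [mulHom_X, mul_one_add, add_sub_cancel_left, pow_two]
  exact Ideal.mul_mem_mul (X_mem_maxIdeal i) (hv i)

/-- The solution of the logarithmic homological equation: there are `u_i ≡ 1` and resonant
`b_i ≡ 0` modulo `𝔪` such that `∂(x_i u_i)` is the image of `x_i (lam_i + b_i)` under the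
endomorphism `x_i ↦ x_i u_i`. -/
theorem exists_normalizing {D : Der 𝕜 n} {lam : Fin n → 𝕜} (hD : IsPerturbation lam D) :
    ∃ v b : Fin n → Ser 𝕜 n, (∀ i, v i ∈ maxIdeal 𝕜 n) ∧ (∀ i, b i ∈ maxIdeal 𝕜 n) ∧
      (∀ i, diagDer lam (b i) = 0) ∧
      ∀ i, D (MvPowerSeries.X i * (1 + v i)) = mulHom (fun i => 1 + v i)
        (MvPowerSeries.X i * (MvPowerSeries.C (lam i) + b i)) := by
  classical
  obtain ⟨hlog, hlam⟩ := hD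
  let e : Fin n → Ser 𝕜 n := fun i => logCoeff D i - MvPowerSeries.C (lam i)
  have he : ∀ i, e i ∈ maxIdeal 𝕜 n := fun i => by
    have := sub_C_mem_maxIdeal (logCoeff D i)
    rwa [hlam] at this
  let E : Der 𝕜 n := D - diagDer lam
  have hE : ∀ i, E (MvPowerSeries.X i) ∈ maxIdeal 𝕜 n ^ 2 := fun i => by
    rw [Derivation.sub_apply, hlog.apply_X, diagDer_X, ← mul_sub, pow_two]
    exact Ideal.mul_mem_mul (X_mem_maxIdeal i) (he i)
  let w : (Fin n →₀ ℕ) → 𝕜 := fun m => ∑ i, lam i * (m i : 𝕜)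
  -- `H` inverts L on nonresonant monomials and, as 0⁻¹ = 0, kills the resonant ones; `P` projects
  -- onto the resonant ones.
  let H : Ser 𝕜 n →ₗ[𝕜] Ser 𝕜 n := diagOp fun m => (w m)⁻¹
  let P : Ser 𝕜 n →ₗ[𝕜] Ser 𝕜 n := diagOp fun m => if w m = 0 then 1 else 0
  have hLH : ∀ f, diagDer lam (H f) + P f = f := by
    intro f
    ext m
    rw [map_add, coeff_diagDer, coeff_diagOp, coeff_diagOp]
    change w m * _ + _ = _
    by_cases h : w m = 0
    · simp [h]
    · simp [h]
  have hLP : ∀ f, diagDer lam (P f) = 0 := by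
    intro f
    ext m
    rw [coeff_diagDer, coeff_diagOp]
    change w m * _ = _
    by_cases h : w m = 0
    · simp [h]
    · simp [h]
  -- The index `true` carries v and `false` carries b. Divided by x_i, the required identity reads L
  -- v_i = b_i - F_i, solved by v_i = -H F_i and b_i = P F_i. Adding b_i inside F leaves b only in
  -- the difference b_i - (1 + v_i) A b_i, where A is the substitution; this difference gains an
  -- order, so F contracts.
  let F : (Fin n × Bool → Ser 𝕜 n) → Fin n → Ser 𝕜 n := fun z i =>
    e i * (1 + z (i, true)) + E (z (i, true))
      - (1 + z (i, true)) * mulHom (fun j => 1 + z (j, true)) (z (i, false)) + z (i, false)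
  have hFmem : ∀ z : Fin n × Bool → Ser 𝕜 n, (∀ p, z p ∈ maxIdeal 𝕜 n ^ 1) →
      ∀ i, F z i ∈ maxIdeal 𝕜 n ^ 1 := by
    intro z hz i
    refine Ideal.add_mem _ (Ideal.sub_mem _ (Ideal.add_mem _ ?_ ?_) ?_) (hz _)
    · exact Ideal.mul_mem_right _ _ (by simpa using he i)
    · exact Ideal.pow_le_pow_right (by omega) (der_mem_pow_succ hE (hz (i, true)))
    · exact Ideal.mul_mem_left _ _ (algHom_mem_pow (mulHom_X_mem _) (hz _))
  have hFcontr : ∀ k, ∀ z w : Fin n × Bool → Ser 𝕜 n, (∀ p, z p ∈ maxIdeal 𝕜 n ^ 1) →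
      (∀ p, w p ∈ maxIdeal 𝕜 n ^ 1) → (∀ p, z p - w p ∈ maxIdeal 𝕜 n ^ k) →
      ∀ i, F z i - F w i ∈ maxIdeal 𝕜 n ^ (k + 1) := by
    intro k z w hz hw h i
    set A := mulHom (fun j => 1 + z (j, true)) with hA
    -- The splitting below gains one order in every term: from a factor in 𝔪, from E, from B - id,
    -- or from A - B, whose values on the variables contain the extra factor x_j.
    set B := mulHom (fun j => 1 + w (j, true)) with hB
    have hsplit : F z i - F w i = (z (i, true) - w (i, true)) * e i
        + E (z (i, true) - w (i, true))
        - (z (i, true) - w (i, true)) * A (z (i, false))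
        - (1 + w (i, true)) * (A (z (i, false)) - B (z (i, false)))
        - (B (z (i, false) - w (i, false)) - (z (i, false) - w (i, false)))
        - B (z (i, false) - w (i, false)) * w (i, true) := by
      simp only [F, map_sub, ← hA, ← hB]
      ring
    have hAB : ∀ f, A f - B f ∈ maxIdeal 𝕜 n ^ (k + 1) :=
      algHom_sub_mem_pow (mulHom_X_mem _) (mulHom_X_mem _) fun j => by
        rw [mulHom_X, mulHom_X, ← mul_sub, add_sub_add_left_eq_sub, pow_succ']
        exact Ideal.mul_mem_mul (X_mem_maxIdeal j) (h _)
    have hBid := algHom_sub_self_mem_pow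
      (mulHom_X_sub_X_mem fun j => by simpa using hw (j, true)) (h (i, false))
    rw [hsplit]
    refine Ideal.sub_mem _ (Ideal.sub_mem _ (Ideal.sub_mem _ (Ideal.sub_mem _ (Ideal.add_mem _
      ?_ ?_) ?_) ?_) hBid) ?_
    · rw [pow_succ]
      exact Ideal.mul_mem_mul (h _) (he i)
    · exact der_mem_pow_succ hE (h _)
    · rw [pow_add]
      exact Ideal.mul_mem_mul (h _) (algHom_mem_pow (mulHom_X_mem _) (hz _))
    · exact Ideal.mul_mem_left _ _ (hAB _)
    · rw [pow_add]
      exact Ideal.mul_mem_mul (algHom_mem_pow (mulHom_X_mem _) (h _)) (hw _)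
  let G : (Fin n × Bool → Ser 𝕜 n) → Fin n × Bool → Ser 𝕜 n := fun z p =>
    bif p.2 then -H (F z p.1) else P (F z p.1)
  obtain ⟨z, hz, hGz⟩ := exists_fixedPoint 1 G
    (by
      rintro z hz ⟨i, _ | _⟩
      · exact diagOp_mem_pow _ (hFmem z hz i)
      · exact neg_mem (diagOp_mem_pow _ (hFmem z hz i)))
    (by
      rintro k - z w hz hw h ⟨i, _ | _⟩
      · change P _ - P _ ∈ _
        rw [← map_sub]
        exact diagOp_mem_pow _ (hFcontr k z w hz hw h i)
      · change -H _ - -H _ ∈ _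
        rw [← neg_sub', ← map_sub]
        exact neg_mem (diagOp_mem_pow _ (hFcontr k z w hz hw h i)))
  have hv : ∀ i, z (i, true) = -H (F z i) := fun i => (congrFun hGz (i, true)).symm
  have hb : ∀ i, z (i, false) = P (F z i) := fun i => (congrFun hGz (i, false)).symm
  refine ⟨fun i => z (i, true), fun i => z (i, false), fun i => by simpa using hz (i, true),
    fun i => by simpa using hz (i, false), fun i => ?_, fun i => ?_⟩
  · beta_reduce
    rw [hb, hLP]
  · have hL : diagDer lam (z (i, true)) = z (i, false) - F z i := by
      rw [hv, hb, map_neg]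
      linear_combination -hLH (F z i)
    have hDv : D (z (i, true)) = diagDer lam (z (i, true)) + E (z (i, true)) := by
      rw [Derivation.sub_apply]
      ring
    have hC : ∀ c : 𝕜, mulHom (fun i => 1 + z (i, true)) (MvPowerSeries.C c) = MvPowerSeries.C c :=
      fun c => AlgHom.commutes _ c
    rw [D.leibniz, hlog.apply_X, map_add, D.map_one_eq_zero, hDv, hL, map_mul, mulHom_X, map_add,
      hC, smul_eq_mul, smul_eq_mul]
    simp only [F, e]
    ring

/-- Formal logarithmic Poincaré–Dulac normal form: a perturbation of `L(lam)` is conjugate to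
`L(lam) + N`, where `N` is nilpotent and commutes with `L(lam)`. -/
theorem exists_conj_jordan {D : Der 𝕜 n} {lam : Fin n → 𝕜} (hD : IsPerturbation lam D) :
    ∃ Φ : Ser 𝕜 n ≃ₐ[𝕜] Ser 𝕜 n, IsPerturbation lam (conj Φ D) ∧
      ∃ (N : Der 𝕜 n) (b : Fin n → Ser 𝕜 n), IsJordanDecomposition (conj Φ D) (diagDer lam) N ∧
        (∀ i, N (MvPowerSeries.X i) = MvPowerSeries.X i * b i) ∧
        ∀ i, diagDer lam (b i) = 0 := by
  obtain ⟨v, b, hv, hb, hres, heq⟩ := exists_normalizing hD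
  -- The normalizing identity says D Ψ = Ψ (L + N) on the variables, so the conjugation is by Ψ⁻¹.
  let Ψ : Ser 𝕜 n ≃ₐ[𝕜] Ser 𝕜 n := AlgEquiv.ofBijective _ (algHom_bijective (mulHom_X_sub_X_mem hv))
  have hX : ∀ i, conj Ψ.symm D (MvPowerSeries.X i)
      = MvPowerSeries.X i * (MvPowerSeries.C (lam i) + b i) := by
    intro i
    rw [conj_apply, AlgEquiv.symm_symm, AlgEquiv.symm_apply_eq]
    change D (mulHom _ _) = mulHom _ _
    rw [← heq, mulHom_X]
  have hN : ∀ i, (conj Ψ.symm D - diagDer lam) (MvPowerSeries.X i) = MvPowerSeries.X i * b i := by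
    intro i
    rw [Derivation.sub_apply, hX, diagDer_X]
    ring
  refine ⟨Ψ.symm, ⟨isLogarithmic_of_apply_X hX, fun i => ?_⟩, conj Ψ.symm D - diagDer lam, b,
    ⟨isLogarithmic_diagDer lam, isLogarithmic_of_apply_X hN, isSemisimpleDer_diagDer lam,
      isNilpotentDer_of_X fun i => ?_, der_ext fun i => ?_, (add_sub_cancel _ _).symm⟩, hN, hres⟩
  · rw [logCoeff_eq (hX i), map_add, mem_maxIdeal_iff.mp (hb i), MvPowerSeries.constantCoeff_C,
      add_zero]
  · rw [hN, pow_two]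
    exact Ideal.mul_mem_mul (X_mem_maxIdeal i) (hb i)
  · rw [Derivation.commutator_apply, hN, diagDer_X, Derivation.leibniz, Derivation.leibniz, hN,
      hres, diagDer_X, show (conj Ψ.symm D - diagDer lam) (MvPowerSeries.C (lam i)) = 0 from
        Derivation.map_algebraMap _ _, Derivation.zero_apply]
    simp only [smul_eq_mul]
    ring

/-- Without constant terms the derivation already raises the order, so it is its own nilpotent part.
This forces `lam` to be nonzero when the semi-simple part is. -/
theorem jordan_of_isPerturbation_zero {D : Der 𝕜 n} (hD : IsPerturbation 0 D) :
    IsJordanDecomposition D 0 D := by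
  have h0 : diagDer (0 : Fin n → 𝕜) = 0 := der_ext fun i => by simp [diagDer_X]
  refine ⟨h0 ▸ isLogarithmic_diagDer 0, hD.1, h0 ▸ isSemisimpleDer_diagDer 0,
    isNilpotentDer_of_X fun i => ?_, zero_lie D, (zero_add D).symm⟩
  rw [hD.1.apply_X, pow_two]
  exact Ideal.mul_mem_mul (X_mem_maxIdeal i) (mem_maxIdeal_iff.mpr (hD.2 i))

/-! ### Invariance of the Bruno ideal and conclusion. -/

/-- The collinearity ideal of `L(lam)` and of a derivation that commutes with `L(lam)` is invariant
under both. -/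
theorem isInvariant_collinearityIdeal {lam : Fin n → 𝕜} {N : Der 𝕜 n} {b : Fin n → Ser 𝕜 n}
    (hN : ∀ i, N (MvPowerSeries.X i) = MvPowerSeries.X i * b i)
    (hb : ∀ i, diagDer lam (b i) = 0) :
    IsInvariant (diagDer lam) (collinearityIdeal (diagDer lam) N) ∧
      IsInvariant N (collinearityIdeal (diagDer lam) N) := by
  classical
  set I := collinearityIdeal (diagDer lam) N with hI
  let γ : Fin n → Fin n → Ser 𝕜 n := fun i j =>
    MvPowerSeries.C (lam i) * b j - MvPowerSeries.C (lam j) * b i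
  have hspan : I = Ideal.span (Set.range fun p : Fin n × Fin n => γ p.1 p.2) := by
    simp only [hI, collinearityIdeal, logCoeff_diagDer, fun i => logCoeff_eq (hN i), γ]
  have hγ : ∀ i j, γ i j ∈ I := fun i j => hspan ▸ Ideal.subset_span ⟨(i, j), rfl⟩
  have hinv : ∀ D : Der 𝕜 n, (∀ i j, D (γ i j) ∈ I) → IsInvariant D I := by
    intro D hD f hf
    rw [hspan] at hf
    refine Submodule.span_induction (p := fun f _ => D f ∈ I) ?_ (by simp) ?_ ?_ hf
    · rintro _ ⟨p, rfl⟩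
      exact hD _ _
    · intro a b _ _ ha hb
      rw [map_add]
      exact Ideal.add_mem _ ha hb
    · intro a b hb hDb
      replace hb : b ∈ I := hspan ▸ hb
      rw [smul_eq_mul, D.leibniz, smul_eq_mul, smul_eq_mul]
      exact Ideal.add_mem _ (Ideal.mul_mem_left _ _ hDb) (Ideal.mul_mem_right _ _ hb)
  have hNC : ∀ c : 𝕜, N (MvPowerSeries.C c) = 0 := fun c => N.map_algebraMap c
  refine ⟨hinv _ fun i j => ?_, hinv _ fun i j => ?_⟩
  · simp only [γ, map_sub, Derivation.leibniz, hb, diagDer_C, smul_zero, add_zero, sub_zero]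
    exact zero_mem _
  -- On x_j this is lam_i b_j = b_i lam_j + γ_ij. Evaluated at the resonant series b_j, the L-term
  -- vanishes and lam_i N(b_j) falls into the ideal; N(γ_ij) is a difference of two such terms.
  · have hexp : ∀ i, (MvPowerSeries.C (lam i) : Ser 𝕜 n) • N
        = b i • diagDer lam + ∑ k, γ i k • diagDer (Pi.single k 1) := by
      intro i
      refine der_ext fun j => ?_
      rw [Derivation.smul_apply, Derivation.add_apply, Derivation.smul_apply,
        ← Derivation.coeFnAddMonoidHom_apply (∑ k, _), map_sum, Finset.sum_apply,
        Finset.sum_eq_single j]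
      · simp only [Derivation.coeFnAddMonoidHom_apply, Derivation.smul_apply, diagDer_X, hN,
          Pi.single_eq_same, map_one, smul_eq_mul, γ]
        ring
      · intro k _ hk
        simp [diagDer_X, Pi.single_eq_of_ne hk.symm]
      · simp
    have hmem : ∀ i j, MvPowerSeries.C (lam i) * N (b j) ∈ I := by
      intro i j
      have := congrArg (fun E : Der 𝕜 n => E (b j)) (hexp i)
      simp only [Derivation.smul_apply, smul_eq_mul] at this
      rw [this, Derivation.add_apply, Derivation.smul_apply, hb, smul_zero, zero_add,
        ← Derivation.coeFnAddMonoidHom_apply (∑ k, _), map_sum, Finset.sum_apply]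
      exact Ideal.sum_mem _ fun k _ => Ideal.mul_mem_right _ _ (hγ i k)
    simp only [γ, map_sub, Derivation.leibniz, hNC, smul_eq_mul, mul_zero, add_zero]
    exact Ideal.sub_mem _ (hmem i j) (hmem j i)

end LogDer

theorem mainTheorem2 {𝕜 : Type*} [RCLike 𝕜] (n : ℕ) (D : LogDer.Der 𝕜 n)
    (hD : LogDer.IsLogarithmic D) :
    ∃ lam : Fin n → 𝕜,
      LogDer.IsPerturbation lam D ∧
      (LogDer.ssPart D ≠ 0 → lam ≠ 0) ∧
      ∃ Φ : LogDer.Ser 𝕜 n ≃ₐ[𝕜] LogDer.Ser 𝕜 n,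
        LogDer.IsNormalFormModulo lam (LogDer.conj Φ D)
          (LogDer.brunoIdeal (LogDer.conj Φ D)) := by
  obtain ⟨lam, hlam⟩ : ∃ lam, LogDer.IsPerturbation lam D := ⟨_, hD, fun _ => rfl⟩
  refine ⟨lam, hlam, ?_, ?_⟩
  · rintro hss rfl
    exact hss (LogDer.jordan_of_isPerturbation_zero hlam).ssPart_eq
  · obtain ⟨Φ, hΦ, N, b, hJ, hN, hb⟩ := LogDer.exists_conj_jordan hlam
    have hinv := LogDer.isInvariant_collinearityIdeal hN hb
    refine ⟨Φ, hΦ, LogDer.isJordanDecomposition_parts hJ, ?_, ?_⟩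
    · rw [LogDer.brunoIdeal, hJ.ssPart_eq, hJ.nilpPart_eq]
      intro f hf
      rw [hJ.sum, Derivation.add_apply]
      exact Ideal.add_mem _ (hinv.1 f hf) (hinv.2 f hf)
    -- After rewriting, the semi-simple part is literally L, so the two quotient derivations
    -- coincide.
    · rw [LogDer.brunoIdeal, hJ.ssPart_eq, hJ.nilpPart_eq]
      exact ⟨hinv.1, hinv.1, rfl⟩
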